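/- **Setting.** Let $Z$ be a metric space. For a metric space $W$ let $\mathcal{P}(W)$ be the set of Borel probability measures on $W$ with finite first moment, with the $\ell_1$-Wasserstein distance $d_{\mathrm W}(\alpha,\beta)=\inf_{\pi\in\mathcal{C}(\alpha,\beta)}\int d_W(w,w')\,\pi(dw\times dw')$, where $\mathcal{C}(\alpha,\beta)$ denotes the set of couplings, i.e. probability measures on the product with marginals $\alpha$ and $\beta$. Let $\mathcal{P}^{\circ 0}(Z)=Z$ and $\mathcal{P}^{\circ(k+1)}(Z)=\mathcal{P}(\mathcal{P}^{\circ k}(Z))$. A *$Z$-labeled measure Markov chain* $(\mathcal{X},\ell_X)$ consists of a finite set $X$, a Markov kernel $x\mapsto m^X_x\in\mathcal{P}(X)$, a stationary distribution $\mu_X$ of $m^X_\bullet$, and a map $\ell_X:X\to Z$. Define $\mathfrak{l}_0=\ell_X$ and $\mathfrak{l}_{k+1}(x)=(\mathfrak{l}_k)_\#m^X_x$, so that $\mathfrak{l}_k:X\to\mathcal{P}^{\circ k}(Z)$, and $\mathfrak{L}_k(\mathcal{X},\ell_X)=(\mathfrak{l}_k)_\#\mu_X\in\mathcal{P}^{\circ(k+1)}(Z)$.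 The *Weisfeiler–Lehman distance of depth $k$* is $$d^{(k)}_{\mathrm{WL}}\big((\mathcal{X},\ell_X),(\mathcal{Y},\ell_Y)\big)=d_{\mathrm W}\big(\mathfrak{L}_k(\mathcal{X},\ell_X),\mathfrak{L}_k(\mathcal{Y},\ell_Y)\big).$$ Let $\mathbb{P}_X$ be the law on $X^{\mathbb{N}}$ ($\mathbb{N}=\{0,1,\dots\}$) of the Markov chain with initial distribution $\mu_X$ and transition kernel $m^X_\bullet$. On $X^{\mathbb{N}}\times Y^{\mathbb{N}}$ let $X_i,Y_i$ be the $i$-th coordinates of the two paths. A coupling $\mathbb{P}\in\mathcal{C}(\mathbb{P}_X,\mathbb{P}_Y)$ is *Markovian* if 1. $(X_i,Y_i)_{i\in\mathbb{N}}$ has the Markov property under $\mathbb{P}$: for all $i\in\mathbb N$ and $z_0,\dots,z_{i+1}\in X\times Y$ with $\mathbb{P}\big((X_j,Y_j)=z_j,\ 0\le j\le i\big)>0$, one has $\mathbb{P}\big((X_{i+1},Y_{i+1})=z_{i+1}\mid (X_j,Y_j)=z_j,\ 0\le j\le i\big)=\mathbb{P}\big((X_{i+1},Y_{i+1})=z_{i+1}\mid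 (X_i,Y_i)=z_i\big)$; 2. for all $i\in\mathbb N$, $x\in X$, $y\in Y$, the conditional law of $(X_{i+1},Y_{i+1})$ given $(X_i,Y_i)=(x,y)$ (taken to be $m^X_x\otimes m^Y_y$ if this event is null) belongs to $\mathcal{C}(m^X_x,m^Y_y)$. Let $\mathcal{C}_{\mathcal M}(\mathbb{P}_X,\mathbb{P}_Y)$ be the set of Markovian couplings. **Theorem.** For all $Z$-labeled measure Markov chains $(\mathcal{X},\ell_X)$ and $(\mathcal{Y},\ell_Y)$ and every $k\in\mathbb{N}$, the distance $d^{(k)}_{\mathrm{WL}}\big((\mathcal{X},\ell_X),(\mathcal{Y},\ell_Y)\big)$ is finite and $$d^{(k)}_{\mathrm{WL}}\big((\mathcal{X},\ell_X),(\mathcal{Y},\ell_Y)\big)=\inf_{\mathbb{P}\in\mathcal{C}_{\mathcal M}(\mathbb{P}_X,\mathbb{P}_Y)}\mathbb{E}_{\mathbb{P}}\,d_Z\big(\ell_X(X_k),\ell_Y(Y_k)\big).$$ -/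

import Mathlib

open MeasureTheory ProbabilityTheory
open scoped ENNReal

noncomputable section

/-! ## Couplings -/

/-- `π` is a coupling of `α` and `β`: its marginals are `α` and `β`. The σ-algebra on `A × B` is
the one carried by `π`. For probability measures `α`, `β`, such a `π` is a probability measure. -/
def IsCoupling {A B : Type*} [MeasurableSpace A] [MeasurableSpace B]
    {m : MeasurableSpace (A × B)} (α : Measure A) (β : Measure B) (π : Measure (A × B)) : Prop :=
  π.map Prod.fst = α ∧ π.map Prod.snd = β

/-! ## Iterated spaces of probability measures with finite first moment -/

/-- A set with a symmetric distance function. It is used only for the spaces `iterP Z k` below,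
which are built from a metric space `Z` by iterating the Wasserstein distance. The triangle
inequality is not recorded, as no definition refers to it. -/
structure DistSpace where
  carrier : Type*
  d : carrier → carrier → ℝ≥0∞
  d_comm : ∀ a b, d a b = d b a

namespace DistSpace

/-- The topology generated by the open balls. If `d` is a metric this is the metric topology, see
`DistSpace.topology_ofMetric` for the spaces of labels. -/
instance topology (A : DistSpace) : TopologicalSpace A.carrier :=
  TopologicalSpace.generateFrom {U | ∃ (a : A.carrier) (r : ℝ≥0∞), U = {b | A.d a b < r}}

instance borelSigma (A : DistSpace) : MeasurableSpace A.carrier := borel A.carrier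

instance borelSpace (A : DistSpace) : BorelSpace A.carrier := ⟨rfl⟩

/-- A metric space, with its own distance. -/
def ofMetric (Z : Type*) [MetricSpace Z] : DistSpace where
  carrier := Z
  d := edist
  d_comm := edist_comm

theorem topology_ofMetric (Z : Type*) [t : MetricSpace Z] :
    topology (ofMetric Z) = t.toPseudoMetricSpace.toUniformSpace.toTopologicalSpace := by
  change (TopologicalSpace.generateFrom
    {U : Set Z | ∃ (a : Z) (r : ℝ≥0∞), U = {b | edist a b < r}} : TopologicalSpace Z) = _
  have hball : ∀ (a : Z) (r : ℝ≥0∞), {b : Z | edist a b < r} = Metric.eball a r := fun a r => by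
    ext b
    rw [Metric.mem_eball, edist_comm, Set.mem_ofPred_eq]
  apply le_antisymm
  · intro U hU
    rw [@isOpen_iff_mem_nhds Z (TopologicalSpace.generateFrom _)]
    intro z hz
    obtain ⟨ε, hε, h⟩ := EMetric.isOpen_iff.1 hU z hz
    have ho := TopologicalSpace.isOpen_generateFrom_of_mem
      (show {b : Z | edist z b < ε} ∈
        {U : Set Z | ∃ (a : Z) (r : ℝ≥0∞), U = {b | edist a b < r}} from ⟨z, ε, rfl⟩)
    refine Filter.mem_of_superset (@IsOpen.mem_nhds Z (TopologicalSpace.generateFrom _) _ _ ho ?_) ((hball z ε).trans_subset h)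
    change edist z z < ε
    rw [edist_self]
    exact hε
  · refine le_generateFrom ?_
    rintro _ ⟨a, r, rfl⟩
    rw [hball]
    exact Metric.isOpen_eball

/-- Borel probability measures `α` with finite first moment: `∫ d(z, z₀) α(dz) < ∞` for any
point `z₀`. -/
structure ProbMeas (A : DistSpace) where
  val : Measure A.carrier
  prob : IsProbabilityMeasure val
  moment : ∀ z₀, ∫⁻ z, A.d z z₀ ∂val < ∞

attribute [instance] ProbMeas.prob

/-- The `ℓ₁` Wasserstein distance: the infimum of `∫ d(z, z') π(dz × dz')` over all couplings `π`,
which are Borel measures on the product space. -/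
def wasserstein (A : DistSpace) (α β : A.ProbMeas) : ℝ≥0∞ :=
  ⨅ (π : @Measure (A.carrier × A.carrier) (borel _)) (_ : IsCoupling α.val β.val π),
    @lintegral _ (borel _) π (fun p => A.d p.1 p.2)

theorem measurable_fst_borel (A : DistSpace) :
    Measurable[borel (A.carrier × A.carrier)] (Prod.fst : A.carrier × A.carrier → A.carrier) := by
  borelize (A.carrier × A.carrier)
  exact continuous_fst.borel_measurable

theorem measurable_snd_borel (A : DistSpace) :
    Measurable[borel (A.carrier × A.carrier)] (Prod.snd : A.carrier × A.carrier → A.carrier) := by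
  borelize (A.carrier × A.carrier)
  exact continuous_snd.borel_measurable

theorem wasserstein_le_swap (A : DistSpace) (α β : A.ProbMeas) :
    A.wasserstein α β ≤ A.wasserstein β α := by
  unfold wasserstein
  refine le_iInf₂ fun π hπ => ?_
  borelize (A.carrier × A.carrier)
  have hs : Measurable (Prod.swap : A.carrier × A.carrier → A.carrier × A.carrier) :=
    continuous_swap.borel_measurable
  have h1 := A.measurable_fst_borel
  have h2 := A.measurable_snd_borel
  have hc : IsCoupling α.val β.val (π.map Prod.swap) := by
    constructor
    · rw [Measure.map_map h1 hs]
      exact hπ.2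
    · rw [Measure.map_map h2 hs]
      exact hπ.1
  refine (iInf₂_le _ hc).trans ((lintegral_map_le _ _).trans (le_of_eq ?_))
  exact lintegral_congr fun p => A.d_comm _ _

/-- The space of Borel probability measures with finite first moment, with the Wasserstein
distance. -/
abbrev P (A : DistSpace) : DistSpace where
  carrier := A.ProbMeas
  d := A.wasserstein
  d_comm α β := le_antisymm (A.wasserstein_le_swap α β) (A.wasserstein_le_swap β α)

/-- The pushforward of a probability measure on a finite set. The points of the image are at finite
distance of all others, which gives the finite first moment. -/
def push {X : Type*} [MeasurableSpace X] [Finite X] [DiscreteMeasurableSpace X]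
    (A : DistSpace) (f : X → A.carrier) (hf : ∀ x a, A.d (f x) a < ∞)
    (m : Measure X) [IsProbabilityMeasure m] : A.ProbMeas :=
  ⟨m.map f, Measure.isProbabilityMeasure_map (measurable_of_countable f).aemeasurable, fun z₀ =>
    (lintegral_map_le _ _).trans_lt <| by
      cases nonempty_fintype X
      rw [lintegral_fintype]
      exact ENNReal.sum_lt_top.2 fun x _ => ENNReal.mul_lt_top (hf x z₀) (measure_lt_top _ _)⟩

theorem d_push_lt_top {X : Type*} [MeasurableSpace X] [Finite X] [DiscreteMeasurableSpace X]
    (A : DistSpace) (f : X → A.carrier) (hf : ∀ x a, A.d (f x) a < ∞)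
    (m : Measure X) [IsProbabilityMeasure m] (β : A.ProbMeas) :
    A.P.d (A.push f hf m) β < ∞ := by
  change A.wasserstein _ β < ∞
  unfold wasserstein
  borelize (A.carrier × A.carrier)
  have h1 := A.measurable_fst_borel
  have h2 := A.measurable_snd_borel
  have hg : Measurable (fun p : X × A.carrier => (f p.1, p.2)) :=
    measurable_from_prod_countable_right fun x =>
      Continuous.borel_measurable (f := fun a : A.carrier => (f x, a))
        (continuous_const.prodMk continuous_id)
  have hf' : Measurable f := measurable_of_countable f
  have hc : IsCoupling (A.push f hf m).val β.val
      ((m.prod β.val).map fun p : X × A.carrier => (f p.1, p.2)) := by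
    constructor
    · rw [Measure.map_map h1 hg]
      change (m.prod β.val).map (f ∘ Prod.fst) = m.map f
      rw [← Measure.map_map hf' measurable_fst, Measure.map_fst_prod]
      simp
    · rw [Measure.map_map h2 hg]
      change (m.prod β.val).map Prod.snd = β.val
      rw [Measure.map_snd_prod]
      simp
  refine (iInf₂_le _ hc).trans_lt ((lintegral_map_le _ _).trans_lt
    ((lintegral_prod_le _).trans_lt ?_))
  cases nonempty_fintype X
  rw [lintegral_fintype]
  refine ENNReal.sum_lt_top.2 fun x _ => ENNReal.mul_lt_top ?_ (measure_lt_top _ _)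
  simpa only [A.d_comm (f x)] using β.moment (f x)

end DistSpace

/-- `P^{∘k}(Z)`: `P^{∘0}(Z) = Z` and `P^{∘(k+1)}(Z) = P(P^{∘k}(Z))`. -/
def iterP (Z : Type*) [MetricSpace Z] : ℕ → DistSpace
  | 0 => DistSpace.ofMetric Z
  | k + 1 => (iterP Z k).P

/-! ## Labeled measure Markov chains -/

/-- A measure Markov chain on (a finite set) `X`: a Markov kernel and a stationary distribution. -/
structure MMC (X : Type*) [MeasurableSpace X] where
  kernel : Kernel X X
  μ : Measure X
  markov : IsMarkovKernel kernel
  prob : IsProbabilityMeasure μ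
  stationary : kernel.Invariant μ

attribute [instance] MMC.markov MMC.prob

/-- A `Z`-labeled measure Markov chain. -/
structure LMMC (X : Type*) [MeasurableSpace X] (Z : Type*) extends MMC X where
  label : X → Z

/-! ## The Weisfeiler-Lehman distance -/

section WL

variable {X Z : Type*} [MeasurableSpace X] [Finite X] [DiscreteMeasurableSpace X] [MetricSpace Z]

/-- The maps `𝔩_k : X → P^{∘k}(Z)`, together with the fact needed to push measures forward along
them. -/
def wlMapAux (𝒳 : LMMC X Z) :
    (k : ℕ) → {f : X → (iterP Z k).carrier // ∀ x a, (iterP Z k).d (f x) a < ∞}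
  | 0 => ⟨𝒳.label, fun _ _ => edist_lt_top _ _⟩
  | k + 1 =>
    ⟨fun x => (iterP Z k).push (wlMapAux 𝒳 k).1 (wlMapAux 𝒳 k).2 (𝒳.kernel x),
     fun x a => (iterP Z k).d_push_lt_top (wlMapAux 𝒳 k).1 (wlMapAux 𝒳 k).2 (𝒳.kernel x) a⟩

/-- `𝔩_k : X → P^{∘k}(Z)`, see `wlMap_zero` and `wlMap_succ`. -/
def wlMap (𝒳 : LMMC X Z) (k : ℕ) : X → (iterP Z k).carrier := (wlMapAux 𝒳 k).1

theorem wlMap_zero (𝒳 : LMMC X Z) : wlMap 𝒳 0 = 𝒳.label := rfl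

/-- `𝔩_{k+1}(x)` is the pushforward of `m_x` along `𝔩_k`. -/
theorem wlMap_succ (𝒳 : LMMC X Z) (k : ℕ) (x : X) :
    (wlMap 𝒳 (k + 1) x : (iterP Z k).ProbMeas).val = (𝒳.kernel x).map (wlMap 𝒳 k) := rfl

/-- `𝔏_k ∈ P^{∘(k+1)}(Z)`: the pushforward of `μ` along `𝔩_k`. -/
def wlMeasure (𝒳 : LMMC X Z) (k : ℕ) : (iterP Z k).ProbMeas :=
  (iterP Z k).push (wlMapAux 𝒳 k).1 (wlMapAux 𝒳 k).2 𝒳.μ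

theorem wlMeasure_val (𝒳 : LMMC X Z) (k : ℕ) :
    (wlMeasure 𝒳 k).val = 𝒳.μ.map (wlMap 𝒳 k) := rfl

/-- The Weisfeiler-Lehman distance of depth `k`. -/
def dWL {Y : Type*} [MeasurableSpace Y] [Finite Y] [DiscreteMeasurableSpace Y]
    (k : ℕ) (𝒳 : LMMC X Z) (𝒴 : LMMC Y Z) : ℝ≥0∞ :=
  (iterP Z k).wasserstein (wlMeasure 𝒳 k) (wlMeasure 𝒴 k)

end WL

/-! ## Path measures and Markovian couplings -/

/-- The path measure on `X^ℕ`: the law of the Markov chain with initial distribution `μ` and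
transition kernel `m`. -/
def MMC.pathMeasure {X : Type*} [MeasurableSpace X] (𝒳 : MMC X) : Measure (ℕ → X) :=
  Kernel.trajMeasure (X := fun _ => X) 𝒳.μ fun n =>
    𝒳.kernel.comap (fun h : (i : Finset.Iic n) → X => h ⟨n, Finset.mem_Iic.2 le_rfl⟩)
      (measurable_pi_apply _)

section Markovian

variable {X Y : Type*} [MeasurableSpace X] [MeasurableSpace Y]

/-- `(X_i, Y_i)` as a random variable on `X^ℕ × Y^ℕ`. -/
def pairAt (i : ℕ) (ω : (ℕ → X) × (ℕ → Y)) : X × Y := (ω.1 i, ω.2 i)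

/-- The Markov property of `(X_i, Y_i)`. The conditional probabilities given the history up to time
`i` are compared whenever this history has positive probability. -/
def HasMarkovProperty (P : Measure ((ℕ → X) × (ℕ → Y))) : Prop :=
  ∀ (i : ℕ) (z : ℕ → X × Y), P {ω | ∀ j ≤ i, pairAt j ω = z j} ≠ 0 →
    P[{ω | pairAt (i + 1) ω = z (i + 1)} | {ω | ∀ j ≤ i, pairAt j ω = z j}] =
      P[{ω | pairAt (i + 1) ω = z (i + 1)} | {ω | pairAt i ω = z i}]

open Classical in
/-- `(ν_{i+1})_{x,y}`: the conditional law of `(X_{i+1}, Y_{i+1})` given `(X_i, Y_i) = (x, y)`, and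
the product measure `m_x ⊗ m_y` if the latter event is null. -/
def stepLaw (𝒳 : MMC X) (𝒴 : MMC Y) (P : Measure ((ℕ → X) × (ℕ → Y))) (i : ℕ) (x : X) (y : Y) :
    Measure (X × Y) :=
  if P {ω | pairAt i ω = (x, y)} = 0 then (𝒳.kernel x).prod (𝒴.kernel y)
  else (P[|{ω | pairAt i ω = (x, y)}]).map (pairAt (i + 1))

/-- Markovian couplings of the path measures of two measure Markov chains. -/
structure IsMarkovianCoupling (𝒳 : MMC X) (𝒴 : MMC Y) (P : Measure ((ℕ → X) × (ℕ → Y))) :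
    Prop where
  coupling : IsCoupling 𝒳.pathMeasure 𝒴.pathMeasure P
  markov : HasMarkovProperty P
  step : ∀ (i : ℕ) (x : X) (y : Y),
    IsCoupling (𝒳.kernel x) (𝒴.kernel y) (stepLaw 𝒳 𝒴 P i x y)

end Markovian

end

/-! Both sides obey the same dynamic programming recursion. Let `wlCost` of depth k be the distance
of 𝔩_k(x) and 𝔩_k(y). It is the least expected cost of depth k-1 over couplings of m_x and m_y
(`wlCost_succ`), and the WL distance is the least expected cost of depth k over couplings of the
stationary laws (`dWL_eq_iInf_wlCost`). For a Markovian coupling each step law is a competitor in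
this recursion, so trading one unit of depth for one unit of time only raises the expected cost;
after k trades the label distance at time k is left. Conversely, a Markov chain of pairs driven by
ε-optimal couplings loses at most ε at the start and ε at each of k steps, so no optimal coupling
has to exist.

The recursion needs the Wasserstein distance of two pushforwards from finite sets to be attained by
couplings on the finite sets (`wasserstein_push`). Since Z is an arbitrary metric space and
couplings live on the Borel σ-algebra of the product, disintegration is replaced by a finite
construction (`exists_lift`). It only needs the points 𝔩_k(x) to have measurable singletons, which
follows as they are at positive distance from every other point (`isSeparated_wlMap`). -/

noncomputable section

/-! ### Finitely supported measures and their Wasserstein distance -/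

namespace DistSpace

variable {A : DistSpace}

theorem measurable_d (a : A.carrier) : Measurable (A.d a) := by
  refine measurable_of_Iio fun r => ?_
  exact (TopologicalSpace.isOpen_generateFrom_of_mem ⟨a, r, rfl⟩ :
    IsOpen {b | A.d a b < r}).measurableSet

theorem wasserstein_self (hA : ∀ a, A.d a a = 0) (α : A.ProbMeas) : A.wasserstein α α = 0 := by
  borelize (A.carrier × A.carrier)
  have h1 := A.measurable_fst_borel
  have h2 := A.measurable_snd_borel
  have hm : Measurable (fun a : A.carrier => (a, a)) :=
    (continuous_id.prodMk continuous_id).borel_measurable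
  have hc : IsCoupling α.val α.val (α.val.map fun a => (a, a)) := by
    constructor
    · rw [Measure.map_map h1 hm]
      exact Measure.map_id
    · rw [Measure.map_map h2 hm]
      exact Measure.map_id
  refine le_antisymm ((iInf₂_le _ hc).trans ((lintegral_map_le _ _).trans ?_)) (zero_le)
  simp [hA]

/-- A point that is at positive distance of all other points. -/
def IsSeparated (A : DistSpace) (a : A.carrier) : Prop := ∀ b, A.d a b = 0 → a = b

theorem IsSeparated.setOf_d_eq_zero (hA : ∀ a, A.d a a = 0) {a : A.carrier}
    (ha : A.IsSeparated a) : {b | A.d a b = 0} = {a} := by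
  ext b
  exact ⟨fun h => (ha b h).symm, fun h => by rw [Set.mem_singleton_iff.1 h]; exact hA a⟩

theorem IsSeparated.measurableSet_singleton (hA : ∀ a, A.d a a = 0) {a : A.carrier}
    (ha : A.IsSeparated a) : MeasurableSet {a} := by
  rw [← ha.setOf_d_eq_zero hA]
  exact measurable_d a (MeasurableSet.singleton 0)

/-- Markov's inequality for the mass that a coupling transports away from a point. -/
theorem mul_singleton_le_add_wasserstein {a : A.carrier} (ha : MeasurableSet {a})
    (α β : A.ProbMeas) (r : ℝ≥0∞) :
    r * α.val {a} ≤ A.wasserstein α β + r * β.val {b | A.d a b < r} := by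
  -- The β-term is moved across so that the infimum stands alone and can be bounded coupling by
  -- coupling.
  rw [← tsub_le_iff_right]
  refine le_iInf₂ fun π hπ => ?_
  rw [tsub_le_iff_right]
  borelize (A.carrier × A.carrier)
  have h1 := A.measurable_fst_borel
  have h2 := A.measurable_snd_borel
  have hB : MeasurableSet {b | A.d a b < r} := measurable_d a measurableSet_Iio
  rw [← hπ.1, ← hπ.2, Measure.map_apply h1 ha, Measure.map_apply h2 hB]
  have hsub : (Prod.fst ⁻¹' {a} : Set (A.carrier × A.carrier)) ⊆
      (Prod.fst ⁻¹' {a} ∩ (Prod.snd ⁻¹' {b | A.d a b < r})ᶜ) ∪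
        Prod.snd ⁻¹' {b | A.d a b < r} := fun p hp => by
    by_cases h : p ∈ Prod.snd ⁻¹' {b | A.d a b < r}
    · exact Or.inr h
    · exact Or.inl ⟨hp, h⟩
  calc r * π (Prod.fst ⁻¹' {a})
      ≤ r * (π (Prod.fst ⁻¹' {a} ∩ (Prod.snd ⁻¹' {b | A.d a b < r})ᶜ) +
          π (Prod.snd ⁻¹' {b | A.d a b < r})) := by
        gcongr
        exact (measure_mono hsub).trans (measure_union_le _ _)
    _ = r * π (Prod.fst ⁻¹' {a} ∩ (Prod.snd ⁻¹' {b | A.d a b < r})ᶜ) +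
          r * π (Prod.snd ⁻¹' {b | A.d a b < r}) := mul_add _ _ _
    _ ≤ _ := by
        gcongr
        rw [← lintegral_indicator_const ((h1 ha).inter (h2 hB).compl)]
        refine lintegral_mono fun p => ?_
        classical
        rw [Set.indicator_apply]
        split_ifs with hp
        · obtain ⟨hp1, hp2⟩ := hp
          rw [show p.1 = a from hp1]
          exact not_lt.1 hp2
        · exact zero_le

/-- At zero transport cost, Markov's inequality gives every ball around a at least the α-mass of a.
By separation the balls shrink to the point, and β is continuous from above. -/
theorem singleton_le_of_wasserstein_eq_zero (hA : ∀ a, A.d a a = 0) {a : A.carrier}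
    (ha : A.IsSeparated a) {α β : A.ProbMeas} (h : A.wasserstein α β = 0) :
    α.val {a} ≤ β.val {a} := by
  have hball : ∀ n : ℕ, α.val {a} ≤ β.val {b | A.d a b < (n + 1 : ℝ≥0∞)⁻¹} := fun n => by
    have hn0 : (n + 1 : ℝ≥0∞)⁻¹ ≠ 0 := by simp
    have hnt : (n + 1 : ℝ≥0∞)⁻¹ ≠ ∞ := by simp
    have := mul_singleton_le_add_wasserstein (ha.measurableSet_singleton hA) α β (n + 1 : ℝ≥0∞)⁻¹
    rw [h, zero_add] at this
    exact (ENNReal.mul_le_mul_iff_right hn0 hnt).1 this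
  have hInter : ({a} : Set A.carrier) = ⋂ n : ℕ, {b | A.d a b < (n + 1 : ℝ≥0∞)⁻¹} := by
    rw [← ha.setOf_d_eq_zero hA]
    ext b
    simp only [Set.mem_ofPred_eq, Set.mem_iInter]
    refine ⟨fun hb n => by simp [hb], fun hb => ?_⟩
    by_contra h0
    obtain ⟨n, hn⟩ := ENNReal.exists_inv_nat_lt h0
    refine (hb n).not_ge (le_trans ?_ hn.le)
    exact ENNReal.inv_le_inv.2 le_self_add
  have hanti : Antitone fun n : ℕ => {b | A.d a b < (n + 1 : ℝ≥0∞)⁻¹} := fun m n hmn b hb =>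
    lt_of_lt_of_le hb (ENNReal.inv_le_inv.2 (by gcongr))
  conv_rhs => rw [hInter]
  rw [hanti.measure_iInter (fun n => (measurable_d a measurableSet_Iio).nullMeasurableSet)
    ⟨0, measure_ne_top _ _⟩]
  exact le_iInf hball

section Push

variable {X : Type*} [MeasurableSpace X] [Finite X] [DiscreteMeasurableSpace X]

/-- The pushforward is carried by finitely many atoms, and a measure at distance zero has at least
the same mass at each of them. It therefore dominates the pushforward, and equal total mass forces
equality. -/
theorem isSeparated_push (hA : ∀ a, A.d a a = 0) (f : X → A.carrier)
    (hf : ∀ x a, A.d (f x) a < ∞) (hs : ∀ x, A.IsSeparated (f x))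
    (m : Measure X) [IsProbabilityMeasure m] : A.P.IsSeparated (A.push f hf m) := by
  classical
  intro β h
  cases nonempty_fintype X
  have hf' : Measurable f := measurable_of_countable f
  have key : (A.push f hf m).val ≤ β.val := by
    refine Measure.le_iff.2 fun s hsm => ?_
    have hpre : (A.push f hf m).val s =
        (A.push f hf m).val (⋃ a ∈ (Finset.univ.image f).filter (· ∈ s), {a}) := by
      have hmeas : MeasurableSet (⋃ a ∈ (Finset.univ.image f).filter (· ∈ s), {a}) := by
        refine Finset.measurableSet_biUnion _ fun a ha => ?_
        obtain ⟨x, -, rfl⟩ := Finset.mem_image.1 (Finset.mem_filter.1 ha).1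
        exact (hs x).measurableSet_singleton hA
      change m.map f s = m.map f _
      rw [Measure.map_apply hf' hsm, Measure.map_apply hf' hmeas]
      congr 1
      ext x
      simp
    have hsing : ∀ a ∈ (Finset.univ.image f).filter (· ∈ s), A.IsSeparated a := fun a ha => by
      obtain ⟨x, -, rfl⟩ := Finset.mem_image.1 (Finset.mem_filter.1 ha).1
      exact hs x
    have hdisj : ((Finset.univ.image f).filter (· ∈ s) : Set A.carrier).PairwiseDisjoint
        fun a => ({a} : Set A.carrier) := fun a _ b _ hab => by simpa using hab
    have hmeas := fun a ha => (hsing a ha).measurableSet_singleton hA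
    rw [hpre, measure_biUnion_finset hdisj hmeas]
    calc _ ≤ ∑ a ∈ (Finset.univ.image f).filter (· ∈ s), β.val {a} :=
          Finset.sum_le_sum fun a ha => singleton_le_of_wasserstein_eq_zero hA (hsing a ha) h
      _ = β.val (⋃ a ∈ (Finset.univ.image f).filter (· ∈ s), {a}) :=
          (measure_biUnion_finset hdisj hmeas).symm
      _ ≤ β.val s := measure_mono (by simp)
  have hval : (A.push f hf m).val = β.val :=
    Measure.eq_of_le_of_measure_univ_eq key (by simp)
  cases β
  rw [ProbMeas.mk.injEq]
  exact hval

/-- A random variable with the same law as `f`, for `f` defined on a finite probability space, can be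
coupled with a point of that space. -/
theorem exists_lift {Ω B : Type*} [MeasurableSpace Ω] [MeasurableSpace B]
    (π : Measure Ω) {u : Ω → B} (hu : Measurable u) (μ : Measure X) [IsFiniteMeasure μ]
    (f : X → B) (hf : ∀ x, MeasurableSet {f x}) (h : π.map u = μ.map f) :
    ∃ γ : Measure (X × Ω), γ.map Prod.fst = μ ∧ γ.map Prod.snd = π ∧
      ∀ᵐ p ∂γ, f p.1 = u p.2 := by
  classical
  cases nonempty_fintype X
  have hf' : Measurable f := measurable_of_countable f
  have hfib : ∀ x, π (u ⁻¹' {f x}) = μ (f ⁻¹' {f x}) := fun x => by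
    rw [← Measure.map_apply hu (hf x), h, Measure.map_apply hf' (hf x)]
  have hm : ∀ x : X, Measurable fun ω : Ω => (x, ω) := fun x => measurable_prodMk_left
  -- On the fibre where u takes the value of f at x, the point x is drawn with its μ-probability
  -- conditional on that value. For a null fibre the weight is 0 / 0 = 0, harmless since π gives the
  -- fibre no mass either.
  refine ⟨∑ x, (μ {x} / μ (f ⁻¹' {f x})) • (π.restrict (u ⁻¹' {f x})).map fun ω => (x, ω),
    ?_, ?_, ?_⟩
  · refine Measure.ext_of_singleton fun x => ?_
    rw [Measure.map_apply measurable_fst (MeasurableSet.singleton x), Measure.finsetSum_apply,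
      Finset.sum_eq_single x]
    · rw [Measure.smul_apply, Measure.map_apply (hm x) (measurable_fst (MeasurableSet.singleton x))]
      have : (fun ω : Ω => (x, ω)) ⁻¹' (Prod.fst ⁻¹' {x}) = Set.univ := by ext; simp
      rw [this, Measure.restrict_apply_univ, hfib, smul_eq_mul]
      refine ENNReal.div_mul_cancel' (fun h0 => ?_) (fun ht => absurd ht (measure_ne_top _ _))
      exact measure_mono_null (by simp) h0
    · intro y _ hy
      rw [Measure.smul_apply, Measure.map_apply (hm y) (measurable_fst (MeasurableSet.singleton x))]
      have : (fun ω : Ω => (y, ω)) ⁻¹' (Prod.fst ⁻¹' {x}) = ∅ := by ext; simp [hy]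
      simp [this]
    · simp
  · refine Measure.ext fun s hs => ?_
    have h1 : ∀ x, ((π.restrict (u ⁻¹' {f x})).map fun ω => (x, ω)) (Prod.snd ⁻¹' s) =
        π (s ∩ u ⁻¹' {f x}) := fun x => by
      rw [Measure.map_apply (hm x) (measurable_snd hs)]
      exact Measure.restrict_apply hs
    rw [Measure.map_apply measurable_snd hs, Measure.finsetSum_apply]
    simp only [Measure.smul_apply, h1, smul_eq_mul]
    -- Almost surely u lies in the finite image of f, so s splits along the fibres of u; the weights
    -- of the points x over one value then sum to one.
    have h2 : π s = ∑ a ∈ Finset.univ.image f, π (s ∩ u ⁻¹' {a}) := by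
      have hR : MeasurableSet (⋃ a ∈ Finset.univ.image f, ({a} : Set B)) := by
        refine Finset.measurableSet_biUnion _ fun a ha => ?_
        obtain ⟨x, -, rfl⟩ := Finset.mem_image.1 ha
        exact hf x
      have hnull : π (u ⁻¹' (⋃ a ∈ Finset.univ.image f, ({a} : Set B)))ᶜ = 0 := by
        rw [← Set.preimage_compl, ← Measure.map_apply hu hR.compl, h,
          Measure.map_apply hf' hR.compl]
        convert measure_empty (μ := μ)
        ext x
        simp
      rw [← measure_inter_conull hnull, ← measure_biUnion_finset]
      · congr 1
        ext ω
        simp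
        exact fun _ => exists_congr fun _ => eq_comm
      · intro a _ b _ hab
        refine Set.disjoint_left.2 fun ω ha hb => hab ?_
        exact ha.2.symm.trans hb.2
      · intro a ha
        obtain ⟨x, -, rfl⟩ := Finset.mem_image.1 ha
        exact hs.inter (hu (hf x))
    rw [h2, ← Finset.sum_fiberwise_of_maps_to
      (fun x _ => Finset.mem_image_of_mem f (Finset.mem_univ x))]
    refine Finset.sum_congr rfl fun a ha => ?_
    obtain ⟨x, -, rfl⟩ := Finset.mem_image.1 ha
    have h3 : ∀ y ∈ Finset.univ.filter (fun y => f y = f x),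
        μ {y} / μ (f ⁻¹' {f y}) * π (s ∩ u ⁻¹' {f y}) =
          μ {y} * ((μ (f ⁻¹' {f x}))⁻¹ * π (s ∩ u ⁻¹' {f x})) := fun y hy => by
      rw [(Finset.mem_filter.1 hy).2, div_eq_mul_inv, mul_assoc]
    have h4 : ∑ y ∈ Finset.univ.filter (fun y => f y = f x), μ {y} = μ (f ⁻¹' {f x}) := by
      rw [sum_measure_singleton]
      congr 1
      ext y
      simp
    rw [Finset.sum_congr rfl h3, ← Finset.sum_mul, h4, ← mul_assoc]
    by_cases h0 : μ (f ⁻¹' {f x}) = 0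
    · rw [measure_mono_null Set.inter_subset_right ((hfib x).trans h0), mul_zero]
    · rw [ENNReal.mul_inv_cancel h0 (measure_ne_top _ _), one_mul]
  · rw [ae_iff, Measure.finsetSum_apply]
    refine Finset.sum_eq_zero fun x _ => ?_
    rw [Measure.smul_apply]
    have hset : MeasurableSet {p : X × Ω | ¬ f p.1 = u p.2} := by
      have : {p : X × Ω | ¬ f p.1 = u p.2} = ⋃ x, {x} ×ˢ (u ⁻¹' {f x})ᶜ := by
        ext p
        simp [eq_comm]
      rw [this]
      exact MeasurableSet.iUnion fun x => (MeasurableSet.singleton x).prod (hu (hf x)).compl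
    rw [Measure.map_apply (hm x) hset, Measure.restrict_apply ((hm x) hset)]
    convert smul_zero _
    convert measure_empty (μ := π)
    ext ω
    simp [eq_comm]

variable {Y : Type*} [MeasurableSpace Y] [Finite Y] [DiscreteMeasurableSpace Y]

/-- The Wasserstein distance of pushforwards from finite sets is computed by couplings on the finite
sets. -/
theorem wasserstein_push (hA : ∀ a, A.d a a = 0)
    (f : X → A.carrier) (hf : ∀ x a, A.d (f x) a < ∞) (hfs : ∀ x, A.IsSeparated (f x))
    (g : Y → A.carrier) (hg : ∀ y a, A.d (g y) a < ∞) (hgs : ∀ y, A.IsSeparated (g y))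
    (μ : Measure X) [IsProbabilityMeasure μ] (ν : Measure Y) [IsProbabilityMeasure ν] :
    A.wasserstein (A.push f hf μ) (A.push g hg ν) =
      ⨅ (γ : Measure (X × Y)) (_ : IsCoupling μ ν γ), ∫⁻ p, A.d (f p.1) (g p.2) ∂γ := by
  classical
  cases nonempty_fintype X
  cases nonempty_fintype Y
  borelize (A.carrier × A.carrier)
  have h1 := A.measurable_fst_borel
  have h2 := A.measurable_snd_borel
  have hf' : Measurable f := measurable_of_countable f
  have hg' : Measurable g := measurable_of_countable g
  have hfm := fun x => (hfs x).measurableSet_singleton hA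
  have hgm := fun y => (hgs y).measurableSet_singleton hA
  apply le_antisymm
  · refine le_iInf₂ fun γ hγ => ?_
    have hfg : Measurable (fun p : X × Y => (f p.1, g p.2)) := measurable_of_countable _
    have hc : IsCoupling (A.push f hf μ).val (A.push g hg ν).val
        (γ.map fun p => (f p.1, g p.2)) := by
      constructor
      · rw [Measure.map_map h1 hfg]
        change γ.map (f ∘ Prod.fst) = μ.map f
        rw [← Measure.map_map hf' measurable_fst, hγ.1]
      · rw [Measure.map_map h2 hfg]
        change γ.map (g ∘ Prod.snd) = ν.map g
        rw [← Measure.map_map hg' measurable_snd, hγ.2]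
    exact (iInf₂_le _ hc).trans (lintegral_map_le _ _)
  · refine le_iInf₂ fun π hπ => ?_
    -- Two successive lifts attach a point of X to the first coordinate and a point of Y to the
    -- second; the joint law of these points is the desired coupling.
    obtain ⟨γ₁, hγ₁μ, hγ₁π, hγ₁⟩ := exists_lift π h1 μ f hfm hπ.1
    have h2' : Measurable fun q : X × (A.carrier × A.carrier) => q.2.2 := h2.comp measurable_snd
    obtain ⟨γ₂, hγ₂ν, hγ₂γ₁, hγ₂⟩ := exists_lift γ₁ h2' ν g hgm (by
      change γ₁.map (Prod.snd ∘ Prod.snd) = _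
      rw [← Measure.map_map h2 measurable_snd, hγ₁π]
      exact hπ.2)
    have hproj : Measurable fun q : Y × (X × (A.carrier × A.carrier)) => (q.2.1, q.1) := by
      fun_prop
    have hc : IsCoupling μ ν (γ₂.map fun q => (q.2.1, q.1)) := by
      constructor
      · rw [Measure.map_map measurable_fst hproj]
        change γ₂.map (Prod.fst ∘ Prod.snd) = μ
        rw [← Measure.map_map measurable_fst measurable_snd, hγ₂γ₁, hγ₁μ]
      · rw [Measure.map_map measurable_snd hproj]
        exact hγ₂ν
    refine (iInf₂_le _ hc).trans ?_
    -- Only the sections `A.d a` are known to be measurable, so the change of variables is made for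
    -- `h`, the distance cut off outside the finite grid of values. It is measurable, at most the
    -- distance, and equal to it along the lift almost everywhere.
    let F : Finset (A.carrier × A.carrier) := Finset.univ.image fun p : X × Y => (f p.1, g p.2)
    let h : A.carrier × A.carrier → ℝ≥0∞ :=
      fun p => ∑ q ∈ F, ({q} : Set (A.carrier × A.carrier)).indicator (fun _ => A.d q.1 q.2) p
    have hh : ∀ p, h p = if p ∈ F then A.d p.1 p.2 else 0 := fun p => by
      simp only [h, Set.indicator_apply, Set.mem_singleton_iff]
      exact Finset.sum_ite_eq F p fun q => A.d q.1 q.2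
    have hhm : Measurable h := by
      refine Finset.measurable_fun_sum _ fun q hq => measurable_const.indicator ?_
      obtain ⟨p, -, rfl⟩ := Finset.mem_image.1 hq
      have : ({(f p.1, g p.2)} : Set (A.carrier × A.carrier)) =
          Prod.fst ⁻¹' {f p.1} ∩ Prod.snd ⁻¹' {g p.2} := by
        ext q
        exact Prod.ext_iff
      rw [this]
      exact (h1 (hfm _)).inter (h2 (hgm _))
    have hγ₁' : ∀ᵐ q ∂γ₂, f q.2.1 = q.2.2.1 := by
      rw [← hγ₂γ₁] at hγ₁
      exact ae_of_ae_map measurable_snd.aemeasurable hγ₁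
    calc ∫⁻ p, A.d (f p.1) (g p.2) ∂(γ₂.map fun q => (q.2.1, q.1))
        ≤ ∫⁻ q, A.d (f q.2.1) (g q.1) ∂γ₂ := lintegral_map_le _ _
      _ = ∫⁻ q, h q.2.2 ∂γ₂ := by
        refine lintegral_congr_ae ?_
        filter_upwards [hγ₁', hγ₂] with q hq1 hq2
        have hq : q.2.2 = (f q.2.1, g q.1) := Prod.ext hq1.symm hq2.symm
        rw [hq, hh, if_pos (Finset.mem_image.2 ⟨(q.2.1, q.1), Finset.mem_univ _, rfl⟩)]
      _ = ∫⁻ p, h p ∂π := by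
        rw [← hγ₁π, ← hγ₂γ₁, Measure.map_map measurable_snd measurable_snd,
          lintegral_map hhm (measurable_snd.comp measurable_snd)]
        rfl
      _ ≤ ∫⁻ p, A.d p.1 p.2 ∂π := by
        refine lintegral_mono fun p => ?_
        rw [hh]
        split_ifs
        · exact le_rfl
        · exact zero_le

end Push

end DistSpace

/-! ### The recursion for the cost on X × Y -/

section WL

variable {X Y Z : Type*} [MetricSpace Z]
  [MeasurableSpace X] [Finite X] [DiscreteMeasurableSpace X]
  [MeasurableSpace Y] [Finite Y] [DiscreteMeasurableSpace Y]

theorem iterP_d_self (k : ℕ) (a : (iterP Z k).carrier) : (iterP Z k).d a a = 0 := by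
  induction k with
  | zero => exact edist_self (α := Z) a
  | succ k ih => exact DistSpace.wasserstein_self ih a

/-- Induction on depth: labels are separated because Z is a metric space, and pushforwards along
separated values are separated. -/
theorem isSeparated_wlMap (𝒳 : LMMC X Z) (k : ℕ) (x : X) :
    (iterP Z k).IsSeparated (wlMap 𝒳 k x) := by
  induction k generalizing x with
  | zero => exact fun b h => eq_of_edist_eq_zero (α := Z) h
  | succ k ih =>
    exact DistSpace.isSeparated_push (iterP_d_self k) (wlMap 𝒳 k) (wlMapAux 𝒳 k).2 ih (𝒳.kernel x)

/-- The distance of `𝔩_k(x)` and `𝔩_k(y)`. -/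
def wlCost (𝒳 : LMMC X Z) (𝒴 : LMMC Y Z) (k : ℕ) (p : X × Y) : ℝ≥0∞ :=
  (iterP Z k).d (wlMap 𝒳 k p.1) (wlMap 𝒴 k p.2)

theorem wlCost_lt_top (𝒳 : LMMC X Z) (𝒴 : LMMC Y Z) (k : ℕ) (p : X × Y) :
    wlCost 𝒳 𝒴 k p < ∞ := (wlMapAux 𝒳 k).2 _ _

theorem wlCost_succ (𝒳 : LMMC X Z) (𝒴 : LMMC Y Z) (k : ℕ) (p : X × Y) :
    wlCost 𝒳 𝒴 (k + 1) p = ⨅ (γ : Measure (X × Y))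
      (_ : IsCoupling (𝒳.kernel p.1) (𝒴.kernel p.2) γ), ∫⁻ q, wlCost 𝒳 𝒴 k q ∂γ :=
  DistSpace.wasserstein_push (iterP_d_self k) _ (wlMapAux 𝒳 k).2 (isSeparated_wlMap 𝒳 k)
    _ (wlMapAux 𝒴 k).2 (isSeparated_wlMap 𝒴 k) (𝒳.kernel p.1) (𝒴.kernel p.2)

theorem dWL_eq_iInf_wlCost (𝒳 : LMMC X Z) (𝒴 : LMMC Y Z) (k : ℕ) :
    dWL k 𝒳 𝒴 = ⨅ (γ : Measure (X × Y)) (_ : IsCoupling 𝒳.μ 𝒴.μ γ), ∫⁻ q, wlCost 𝒳 𝒴 k q ∂γ :=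
  DistSpace.wasserstein_push (iterP_d_self k) _ (wlMapAux 𝒳 k).2 (isSeparated_wlMap 𝒳 k)
    _ (wlMapAux 𝒴 k).2 (isSeparated_wlMap 𝒴 k) 𝒳.μ 𝒴.μ

theorem dWL_lt_top (𝒳 : LMMC X Z) (𝒴 : LMMC Y Z) (k : ℕ) : dWL k 𝒳 𝒴 < ∞ :=
  DistSpace.d_push_lt_top _ _ (wlMapAux 𝒳 k).2 _ _

end WL

/-! ### Inhomogeneous Markov chains and their images -/

section Chain

open Preorder

variable {S : Type*} [MeasurableSpace S]

/-- The law of an inhomogeneous Markov chain on `S`. -/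
def chainMeasure (ρ : Measure S) (K : ℕ → Kernel S S) [∀ n, IsMarkovKernel (K n)] :
    Measure (ℕ → S) :=
  Kernel.trajMeasure (X := fun _ => S) ρ fun n =>
    (K n).comap (fun h : (i : Finset.Iic n) → S => h ⟨n, Finset.mem_Iic.2 le_rfl⟩)
      (measurable_pi_apply _)

theorem MMC.pathMeasure_eq_chainMeasure (𝒳 : MMC S) :
    𝒳.pathMeasure = chainMeasure 𝒳.μ fun _ => 𝒳.kernel := rfl

variable (ρ : Measure S) (K : ℕ → Kernel S S) [∀ n, IsMarkovKernel (K n)]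

instance [IsProbabilityMeasure ρ] : IsProbabilityMeasure (chainMeasure ρ K) := by
  unfold chainMeasure
  infer_instance

theorem chainMeasure_map_zero : (chainMeasure ρ K).map (fun ω => ω 0) = ρ := by
  have hf : (fun ω : ℕ → S => ω 0) =
      (fun h : (i : Finset.Iic 0) → S => h ⟨0, Finset.mem_Iic.2 le_rfl⟩) ∘
        frestrictLe (π := fun _ => S) 0 := rfl
  rw [hf, ← Measure.map_map (by fun_prop) (by fun_prop), chainMeasure, Kernel.trajMeasure,
    Measure.map_comp _ _ (by fun_prop), Kernel.traj_map_frestrictLe, Kernel.partialTraj_self,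
    Measure.id_comp, Measure.map_map (by fun_prop) (by fun_prop)]
  exact Measure.map_id

variable [IsProbabilityMeasure ρ]

/-- The law of the history and the next state. -/
theorem chainMeasure_map_frestrictLe_compProd (n : ℕ) :
    (chainMeasure ρ K).map (frestrictLe (π := fun _ => S) n) ⊗ₘ
        (K n).comap (fun h : (i : Finset.Iic n) → S => h ⟨n, Finset.mem_Iic.2 le_rfl⟩)
          (measurable_pi_apply _) =
      (chainMeasure ρ K).map fun ω => (frestrictLe (π := fun _ => S) n ω, ω (n + 1)) :=
  Kernel.map_frestrictLe_trajMeasure_compProd_eq_map_trajMeasure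

/-- Appending a state to a history. -/
def appendState (n : ℕ) (p : ((i : Finset.Iic n) → S) × S) (i : Finset.Iic (n + 1)) : S :=
  if h : i.1 ≤ n then p.1 ⟨i.1, Finset.mem_Iic.2 h⟩ else p.2

theorem measurable_appendState (n : ℕ) : Measurable (appendState (S := S) n) := by
  refine measurable_pi_lambda _ fun i => ?_
  unfold appendState
  split_ifs <;> fun_prop

theorem appendState_frestrictLe {S : Type*} (n : ℕ) (ω : ℕ → S) :
    appendState n (frestrictLe (π := fun _ => S) n ω, ω (n + 1)) =
      frestrictLe (π := fun _ => S) (n + 1) ω := by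
  ext i
  unfold appendState
  split_ifs with h
  · rfl
  · have hi := Finset.mem_Iic.1 i.2
    have : i.1 = n + 1 := by omega
    rw [frestrictLe_apply, this]

/-- The law of a Markov chain is determined by its initial law and its transitions. -/
theorem eq_chainMeasure (Q : Measure (ℕ → S)) [IsFiniteMeasure Q]
    (h0 : Q.map (fun ω => ω 0) = ρ)
    (hs : ∀ n, Q.map (frestrictLe (π := fun _ => S) n) ⊗ₘ
        (K n).comap (fun h : (i : Finset.Iic n) → S => h ⟨n, Finset.mem_Iic.2 le_rfl⟩)
          (measurable_pi_apply _) =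
      Q.map fun ω => (frestrictLe (π := fun _ => S) n ω, ω (n + 1))) :
    Q = chainMeasure ρ K := by
  -- The laws of initial segments agree by induction. Every finite set of times lies in such a
  -- segment, so uniqueness of projective limits concludes.
  have key : ∀ n, Q.map (frestrictLe (π := fun _ => S) n) =
      (chainMeasure ρ K).map (frestrictLe (π := fun _ => S) n) := by
    intro n
    induction n with
    | zero =>
      have hf : frestrictLe (π := fun _ => S) 0 = (fun (s : S) _ => s) ∘ fun ω => ω 0 := by
        ext ω i
        have : i.1 = 0 := Nat.le_zero.1 (Finset.mem_Iic.1 i.2)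
        simp [frestrictLe_apply, this]
      rw [hf, ← Measure.map_map (by fun_prop) (by fun_prop),
        ← Measure.map_map (by fun_prop) (by fun_prop), h0, chainMeasure_map_zero]
    | succ n ih =>
      have hf : frestrictLe (π := fun _ => S) (n + 1) =
          appendState n ∘ fun ω => (frestrictLe (π := fun _ => S) n ω, ω (n + 1)) :=
        funext fun ω => (appendState_frestrictLe n ω).symm
      rw [hf, ← Measure.map_map (measurable_appendState n) (by fun_prop),
        ← Measure.map_map (measurable_appendState n) (by fun_prop), ← hs, ih,
        chainMeasure_map_frestrictLe_compProd]
  have hI : ∀ (I : Finset ℕ), Q.map (I.restrict (π := fun _ => S)) =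
      (chainMeasure ρ K).map (I.restrict (π := fun _ => S)) := by
    intro I
    have hsub : I ⊆ Finset.Iic (I.sup id) := I.subset_Iic_sup_id
    have hr : Measurable (Finset.restrict₂ (π := fun _ : ℕ => S) hsub) :=
      Finset.measurable_restrict₂ hsub
    have hf : Measurable (frestrictLe (π := fun _ : ℕ => S) (I.sup id)) := by fun_prop
    rw [← Finset.restrict₂_comp_restrict hsub]
    refine (Measure.map_map hr hf).symm.trans (Eq.trans ?_ (Measure.map_map hr hf))
    exact congrArg _ (key _)
  exact IsProjectiveLimit.unique (α := fun _ => S) (P := fun I : Finset ℕ =>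
    (chainMeasure ρ K).map (I.restrict (π := fun _ => S))) hI fun _ => rfl

theorem lintegral_chainMeasure_succ (n : ℕ) {h : S → ℝ≥0∞} (hh : Measurable h) :
    ∫⁻ ω, h (ω (n + 1)) ∂chainMeasure ρ K =
      ∫⁻ ω, ∫⁻ s, h s ∂(K n (ω n)) ∂chainMeasure ρ K := by
  have hk : Measurable fun s => ∫⁻ s', h s' ∂(K n s) := hh.lintegral_kernel
  calc ∫⁻ ω, h (ω (n + 1)) ∂chainMeasure ρ K
      = ∫⁻ p, h p.2 ∂((chainMeasure ρ K).map
          fun ω => (frestrictLe (π := fun _ => S) n ω, ω (n + 1))) := by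
        rw [lintegral_map (by fun_prop) (by fun_prop)]
    _ = _ := by
        rw [← chainMeasure_map_frestrictLe_compProd, Measure.lintegral_compProd (by fun_prop),
          lintegral_map]
        · rfl
        · exact hk.comp (measurable_pi_apply _)
        · fun_prop

/-- Given a history whose last state is `s`, the next state has law `K n s`. -/
theorem chainMeasure_history_inter (n : ℕ) {H : Set ((i : Finset.Iic n) → S)}
    (hH : MeasurableSet H) {s : S} (hs : ∀ h ∈ H, h ⟨n, Finset.mem_Iic.2 le_rfl⟩ = s)
    {B : Set S} (hB : MeasurableSet B) :
    chainMeasure ρ K (frestrictLe (π := fun _ => S) n ⁻¹' H ∩ {ω | ω (n + 1) ∈ B}) =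
      chainMeasure ρ K (frestrictLe (π := fun _ => S) n ⁻¹' H) * K n s B := by
  have h1 : frestrictLe (π := fun _ => S) n ⁻¹' H ∩ {ω | ω (n + 1) ∈ B} =
      (fun ω => (frestrictLe (π := fun _ => S) n ω, ω (n + 1))) ⁻¹' (H ×ˢ B) := rfl
  rw [h1, ← Measure.map_apply (by fun_prop) (hH.prod hB), ← chainMeasure_map_frestrictLe_compProd,
    Measure.compProd_apply_prod hH hB, setLIntegral_congr_fun hH
      (g := fun _ => K n s B), setLIntegral_const, mul_comm, Measure.map_apply (by fun_prop) hH]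
  intro h hh
  simp only [Kernel.comap_apply, hs h hh]

/-- A function of a Markov chain is a Markov chain if the transitions only depend on the value of
the function. -/
theorem chainMeasure_map {T : Type*} [MeasurableSpace T] {f : S → T} (hf : Measurable f)
    (L : ℕ → Kernel T T) [∀ n, IsMarkovKernel (L n)]
    (h : ∀ n s, (K n s).map f = L n (f s)) :
    (chainMeasure ρ K).map (fun ω i => f (ω i)) = chainMeasure (ρ.map f) L := by
  have : IsProbabilityMeasure (ρ.map f) := Measure.isProbabilityMeasure_map hf.aemeasurable
  have hF : Measurable fun (ω : ℕ → S) i => f (ω i) := by fun_prop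
  refine eq_chainMeasure _ _ _ ?_ fun n => ?_
  · rw [Measure.map_map (by fun_prop) hF]
    conv_rhs => rw [← chainMeasure_map_zero ρ K]
    rw [Measure.map_map hf (by fun_prop)]
    rfl
  · let Φ : ((i : Finset.Iic n) → S) → ((i : Finset.Iic n) → T) := fun h i => f (h i)
    have hΦ : Measurable Φ := by fun_prop
    have e1 : ((chainMeasure ρ K).map fun ω i => f (ω i)).map (frestrictLe (π := fun _ => T) n) =
        ((chainMeasure ρ K).map (frestrictLe (π := fun _ => S) n)).map Φ := by
      rw [Measure.map_map (by fun_prop) hF, Measure.map_map hΦ (by fun_prop)]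
      rfl
    have e2 : ((chainMeasure ρ K).map fun ω i => f (ω i)).map
          (fun ω => (frestrictLe (π := fun _ => T) n ω, ω (n + 1))) =
        ((chainMeasure ρ K).map fun ω =>
          (frestrictLe (π := fun _ => S) n ω, ω (n + 1))).map (Prod.map Φ f) := by
      rw [Measure.map_map (by fun_prop) hF, Measure.map_map (by fun_prop) (by fun_prop)]
      rfl
    have : IsProbabilityMeasure ((chainMeasure ρ K).map (frestrictLe (π := fun _ => S) n)) :=
      Measure.isProbabilityMeasure_map (by fun_prop)
    have : IsProbabilityMeasure
        (((chainMeasure ρ K).map (frestrictLe (π := fun _ => S) n)).map Φ) :=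
      Measure.isProbabilityMeasure_map hΦ.aemeasurable
    rw [e1, e2, ← chainMeasure_map_frestrictLe_compProd]
    refine Measure.ext fun s hs => ?_
    rw [Measure.compProd_apply hs, Measure.map_apply (by fun_prop) hs,
      Measure.compProd_apply (hs.preimage (by fun_prop)),
      lintegral_map (Kernel.measurable_kernel_prodMk_left hs) hΦ]
    refine lintegral_congr fun x => ?_
    rw [Kernel.comap_apply, Kernel.comap_apply, ← h, Measure.map_apply hf (measurable_prodMk_left hs)]
    rfl

end Chain

/-! ### Markovian couplings built from, and integrated through, step laws -/

section Markovian

open Preorder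

variable {X Y : Type*} [MeasurableSpace X] [MeasurableSpace Y]

theorem measurable_pairAt (i : ℕ) : Measurable (pairAt (X := X) (Y := Y) i) := by
  unfold pairAt
  fun_prop

/-- A path of pairs as a pair of paths. -/
def unzipPath (ω : ℕ → X × Y) : (ℕ → X) × (ℕ → Y) := (fun i => (ω i).1, fun i => (ω i).2)

theorem measurable_unzipPath : Measurable (unzipPath (X := X) (Y := Y)) := by
  unfold unzipPath
  fun_prop

theorem IsCoupling.isProbabilityMeasure {α : Measure X} [IsProbabilityMeasure α] {β : Measure Y}
    {π : Measure (X × Y)} (h : IsCoupling α β π) : IsProbabilityMeasure π := by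
  constructor
  rw [← Set.preimage_univ (f := Prod.fst), ← Measure.map_apply measurable_fst MeasurableSet.univ,
    h.1, measure_univ]

theorem isCoupling_prod (α : Measure X) [IsProbabilityMeasure α] (β : Measure Y)
    [IsProbabilityMeasure β] : IsCoupling α β (α.prod β) := by
  constructor
  · simp [Measure.map_fst_prod]
  · simp [Measure.map_snd_prod]

instance (𝒳 : MMC X) : IsProbabilityMeasure 𝒳.pathMeasure := by
  rw [MMC.pathMeasure_eq_chainMeasure]
  infer_instance

section Unzip

variable (ρ : Measure (X × Y)) [IsProbabilityMeasure ρ] (K : ℕ → Kernel (X × Y) (X × Y))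
  [∀ n, IsMarkovKernel (K n)]

instance : IsProbabilityMeasure ((chainMeasure ρ K).map unzipPath) :=
  Measure.isProbabilityMeasure_map measurable_unzipPath.aemeasurable

/-- Conditioning is allowed on any event of the past that fixes the present state. Full histories
and the present state alone are both such events, so this yields the Markov property and the step
laws together. -/
theorem cond_map_unzipPath (n : ℕ) {H : Set ((i : Finset.Iic n) → X × Y)} (hH : MeasurableSet H)
    {s : X × Y} (hs : ∀ h ∈ H, h ⟨n, Finset.mem_Iic.2 le_rfl⟩ = s)
    {B : Set (X × Y)} (hB : MeasurableSet B) {E : Set ((ℕ → X) × (ℕ → Y))}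
    (hE : E = {ω | frestrictLe (π := fun _ => X × Y) n (fun i => pairAt i ω) ∈ H})
    (h0 : (chainMeasure ρ K).map unzipPath E ≠ 0) :
    ((chainMeasure ρ K).map unzipPath)[{ω | pairAt (n + 1) ω ∈ B} | E] = K n s B := by
  have hEm : MeasurableSet E := by
    have : Measurable fun ω : (ℕ → X) × (ℕ → Y) =>
        frestrictLe (π := fun _ => X × Y) n (fun i => pairAt i ω) := by
      unfold pairAt
      fun_prop
    rw [hE]
    exact this hH
  have hBm : MeasurableSet {ω : (ℕ → X) × (ℕ → Y) | pairAt (n + 1) ω ∈ B} :=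
    measurable_pairAt _ hB
  rw [cond_apply hEm]
  have e1 : (chainMeasure ρ K).map unzipPath E =
      chainMeasure ρ K (frestrictLe (π := fun _ => X × Y) n ⁻¹' H) := by
    rw [Measure.map_apply measurable_unzipPath hEm, hE]
    rfl
  have e2 : (chainMeasure ρ K).map unzipPath (E ∩ {ω | pairAt (n + 1) ω ∈ B}) =
      (chainMeasure ρ K).map unzipPath E * K n s B := by
    rw [e1, ← chainMeasure_history_inter ρ K n hH hs hB,
      Measure.map_apply measurable_unzipPath (hEm.inter hBm), hE]
    rfl
  rw [e2, ← mul_assoc, ENNReal.inv_mul_cancel h0 (measure_ne_top _ _), one_mul]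

variable [MeasurableSingletonClass X] [MeasurableSingletonClass Y]

theorem measurableSet_lastState_eq {S : Type*} [MeasurableSpace S] [MeasurableSingletonClass S]
    (n : ℕ) (s : S) :
    MeasurableSet {h : (j : Finset.Iic n) → S | h ⟨n, Finset.mem_Iic.2 le_rfl⟩ = s} :=
  (measurable_pi_apply _ : Measurable fun h : (j : Finset.Iic n) → S =>
    h ⟨n, Finset.mem_Iic.2 le_rfl⟩) (MeasurableSet.singleton s)

theorem hasMarkovProperty_map_unzipPath :
    HasMarkovProperty ((chainMeasure ρ K).map unzipPath) := by
  intro i z h0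
  have h0' : (chainMeasure ρ K).map unzipPath {ω | pairAt i ω = z i} ≠ 0 := fun h =>
    h0 (measure_mono_null (fun ω hω => hω i le_rfl) h)
  refine (cond_map_unzipPath ρ K i (MeasurableSet.singleton fun j : Finset.Iic i => z j) (s := z i)
    ?_ (MeasurableSet.singleton (z (i + 1))) ?_ h0).trans
    (cond_map_unzipPath ρ K i (measurableSet_lastState_eq i (z i)) (fun h hh => hh) (MeasurableSet.singleton (z (i + 1)))
      rfl h0').symm
  · rintro h rfl
    rfl
  · ext ω
    simp [funext_iff, frestrictLe_apply]

theorem stepLaw_map_unzipPath (𝒳 : MMC X) (𝒴 : MMC Y) (i : ℕ) (x : X) (y : Y)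
    (h0 : (chainMeasure ρ K).map unzipPath {ω | pairAt i ω = (x, y)} ≠ 0) :
    stepLaw 𝒳 𝒴 ((chainMeasure ρ K).map unzipPath) i x y = K i (x, y) := by
  rw [stepLaw, if_neg h0]
  refine Measure.ext fun B hB => ?_
  rw [Measure.map_apply (measurable_pairAt _) hB]
  exact cond_map_unzipPath ρ K i (measurableSet_lastState_eq i (x, y)) (fun h hh => hh) hB rfl h0

/-- The marginals of the transition from (x, y) depend only on x and only on y, so each coordinate
is itself a Markov chain with the right law. At null states the product measure is a coupling
anyway. -/
theorem isMarkovianCoupling_map_unzipPath (𝒳 : MMC X) (𝒴 : MMC Y) (hρ : IsCoupling 𝒳.μ 𝒴.μ ρ)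
    (hK : ∀ n p, IsCoupling (𝒳.kernel p.1) (𝒴.kernel p.2) (K n p)) :
    IsMarkovianCoupling 𝒳 𝒴 ((chainMeasure ρ K).map unzipPath) where
  coupling := by
    constructor
    · rw [Measure.map_map measurable_fst measurable_unzipPath, MMC.pathMeasure_eq_chainMeasure,
        ← hρ.1]
      exact chainMeasure_map ρ K measurable_fst (fun _ => 𝒳.kernel) fun n p => (hK n p).1
    · rw [Measure.map_map measurable_snd measurable_unzipPath, MMC.pathMeasure_eq_chainMeasure,
        ← hρ.2]
      exact chainMeasure_map ρ K measurable_snd (fun _ => 𝒴.kernel) fun n p => (hK n p).2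
  markov := hasMarkovProperty_map_unzipPath ρ K
  step i x y := by
    by_cases h0 : (chainMeasure ρ K).map unzipPath {ω | pairAt i ω = (x, y)} = 0
    · rw [stepLaw, if_pos h0]
      exact isCoupling_prod _ _
    · rw [stepLaw_map_unzipPath ρ K 𝒳 𝒴 i x y h0]
      exact hK i (x, y)

end Unzip

variable [Finite X] [DiscreteMeasurableSpace X] [Finite Y] [DiscreteMeasurableSpace Y]

/-- Tower property, by splitting over the finitely many states at time i. Null states contribute
nothing, so the default value of `stepLaw` does not matter. -/
theorem lintegral_pairAt_succ (𝒳 : MMC X) (𝒴 : MMC Y) (P : Measure ((ℕ → X) × (ℕ → Y)))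
    [IsFiniteMeasure P] (i : ℕ) (h : X × Y → ℝ≥0∞) :
    ∫⁻ ω, h (pairAt (i + 1) ω) ∂P =
      ∫⁻ ω, ∫⁻ q, h q ∂stepLaw 𝒳 𝒴 P i (pairAt i ω).1 (pairAt i ω).2 ∂P := by
  have hE : ∀ z : X × Y, MeasurableSet {ω : (ℕ → X) × (ℕ → Y) | pairAt i ω = z} := fun z =>
    measurable_pairAt i (MeasurableSet.singleton z)
  have hsum : ∀ F : (ℕ → X) × (ℕ → Y) → ℝ≥0∞,
      ∫⁻ ω, F ω ∂P = ∑' z : X × Y, ∫⁻ ω in {ω | pairAt i ω = z}, F ω ∂P := fun F => by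
    rw [← lintegral_iUnion hE, show ⋃ z : X × Y, {ω : (ℕ → X) × (ℕ → Y) | pairAt i ω = z} =
      Set.univ by ext; simp, Measure.restrict_univ]
    intro z w hzw
    exact Set.disjoint_left.2 fun ω h1 h2 => hzw (h1.symm.trans h2)
  rw [hsum, hsum]
  refine tsum_congr fun z => ?_
  by_cases h0 : P {ω | pairAt i ω = z} = 0
  · rw [setLIntegral_measure_zero _ _ h0, setLIntegral_measure_zero _ _ h0]
  · rw [setLIntegral_congr_fun (hE z) (f := fun ω =>
        ∫⁻ q, h q ∂stepLaw 𝒳 𝒴 P i (pairAt i ω).1 (pairAt i ω).2)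
      (g := fun _ => ∫⁻ q, h q ∂stepLaw 𝒳 𝒴 P i z.1 z.2)
      (fun ω hω => by simp only [show pairAt i ω = z from hω]), setLIntegral_const, stepLaw,
      if_neg h0, lintegral_map (measurable_of_countable h) (measurable_pairAt _), ProbabilityTheory.cond,
      lintegral_smul_measure, smul_eq_mul, mul_right_comm,
      ENNReal.inv_mul_cancel h0 (measure_ne_top _ _), one_mul]

end Markovian

/-! ### The two inequalities -/

section WL

variable {X Y Z : Type*} [MetricSpace Z]
  [MeasurableSpace X] [Finite X] [DiscreteMeasurableSpace X]
  [MeasurableSpace Y] [Finite Y] [DiscreteMeasurableSpace Y]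

theorem lintegral_wlCost_le (𝒳 : LMMC X Z) (𝒴 : LMMC Y Z) {P : Measure ((ℕ → X) × (ℕ → Y))}
    (hP : IsMarkovianCoupling 𝒳.toMMC 𝒴.toMMC P) (j i : ℕ) :
    ∫⁻ ω, wlCost 𝒳 𝒴 j (pairAt i ω) ∂P ≤ ∫⁻ ω, wlCost 𝒳 𝒴 0 (pairAt (i + j) ω) ∂P := by
  have : IsProbabilityMeasure P := hP.coupling.isProbabilityMeasure
  induction j generalizing i with
  | zero => exact le_rfl
  | succ j ih =>
    calc ∫⁻ ω, wlCost 𝒳 𝒴 (j + 1) (pairAt i ω) ∂P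
        ≤ ∫⁻ ω, ∫⁻ q, wlCost 𝒳 𝒴 j q
            ∂stepLaw 𝒳.toMMC 𝒴.toMMC P i (pairAt i ω).1 (pairAt i ω).2 ∂P := by
          refine lintegral_mono fun ω => ?_
          rw [wlCost_succ]
          exact iInf₂_le _ (hP.step i _ _)
      _ = ∫⁻ ω, wlCost 𝒳 𝒴 j (pairAt (i + 1) ω) ∂P := (lintegral_pairAt_succ _ _ P i _).symm
      _ ≤ _ := by
        have := ih (i + 1)
        rwa [add_right_comm, add_assoc i j 1] at this

theorem dWL_le_of_isMarkovianCoupling (𝒳 : LMMC X Z) (𝒴 : LMMC Y Z)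
    {P : Measure ((ℕ → X) × (ℕ → Y))} (hP : IsMarkovianCoupling 𝒳.toMMC 𝒴.toMMC P) (k : ℕ) :
    dWL k 𝒳 𝒴 ≤ ∫⁻ ω, wlCost 𝒳 𝒴 0 (pairAt k ω) ∂P := by
  have hc : IsCoupling 𝒳.μ 𝒴.μ (P.map (pairAt 0)) := by
    constructor
    · rw [← chainMeasure_map_zero 𝒳.μ fun _ => 𝒳.kernel, ← MMC.pathMeasure_eq_chainMeasure,
        ← hP.coupling.1, Measure.map_map measurable_fst (measurable_pairAt 0),
        Measure.map_map (by fun_prop) measurable_fst]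
      rfl
    · rw [← chainMeasure_map_zero 𝒴.μ fun _ => 𝒴.kernel, ← MMC.pathMeasure_eq_chainMeasure,
        ← hP.coupling.2, Measure.map_map measurable_snd (measurable_pairAt 0),
        Measure.map_map (by fun_prop) measurable_snd]
      rfl
  rw [dWL_eq_iInf_wlCost]
  refine (iInf₂_le _ hc).trans ?_
  rw [lintegral_map (measurable_of_countable _) (measurable_pairAt 0)]
  simpa using lintegral_wlCost_le 𝒳 𝒴 hP k 0

theorem exists_isMarkovianCoupling_le (𝒳 : LMMC X Z) (𝒴 : LMMC Y Z) (k : ℕ) {ε : ℝ≥0∞}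
    (hε : ε ≠ 0) :
    ∃ P, IsMarkovianCoupling 𝒳.toMMC 𝒴.toMMC P ∧
      ∫⁻ ω, wlCost 𝒳 𝒴 0 (pairAt k ω) ∂P ≤ dWL k 𝒳 𝒴 + (k + 1) * ε := by
  have hγ : ∃ γ : Measure (X × Y), IsCoupling 𝒳.μ 𝒴.μ γ ∧
      ∫⁻ q, wlCost 𝒳 𝒴 k q ∂γ < dWL k 𝒳 𝒴 + ε := by
    -- Finiteness makes adding ε a strict increase, so an ε-optimal coupling exists.
    have := ENNReal.lt_add_right (dWL_lt_top 𝒳 𝒴 k).ne hε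
    conv_lhs at this => rw [dWL_eq_iInf_wlCost]
    simpa only [iInf_lt_iff, exists_prop] using this
  have hκ : ∀ (j : ℕ) (p : X × Y), ∃ γ : Measure (X × Y),
      IsCoupling (𝒳.kernel p.1) (𝒴.kernel p.2) γ ∧
      ∫⁻ q, wlCost 𝒳 𝒴 j q ∂γ < wlCost 𝒳 𝒴 (j + 1) p + ε := fun j p => by
    have := ENNReal.lt_add_right (wlCost_lt_top 𝒳 𝒴 (j + 1) p).ne hε
    conv_lhs at this => rw [wlCost_succ]
    simpa only [iInf_lt_iff, exists_prop] using this
  obtain ⟨γ, hγ, hγε⟩ := hγ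
  choose κ hκ hκε using hκ
  -- At time n < k the remaining depth is k - n, and the step must be nearly optimal for the cost of
  -- depth k - n - 1. From time k on the subtraction truncates to 0, and any coupling would do.
  let K : ℕ → Kernel (X × Y) (X × Y) := fun n => ⟨κ (k - n - 1), measurable_of_countable _⟩
  have hKp : ∀ n, IsMarkovKernel (K n) := fun n =>
    ⟨fun p => (hκ (k - n - 1) p).isProbabilityMeasure⟩
  have hγp : IsProbabilityMeasure γ := hγ.isProbabilityMeasure
  refine ⟨(chainMeasure γ K).map unzipPath,
    isMarkovianCoupling_map_unzipPath γ K _ _ hγ fun n p => hκ _ p, ?_⟩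
  have key : ∀ j i, i + j = k → ∫⁻ ω, wlCost 𝒳 𝒴 0 (ω k) ∂chainMeasure γ K ≤
      ∫⁻ ω, wlCost 𝒳 𝒴 j (ω i) ∂chainMeasure γ K + j * ε := by
    intro j
    induction j with
    | zero =>
      rintro i rfl
      simp
    | succ j ih =>
      intro i hi
      calc ∫⁻ ω, wlCost 𝒳 𝒴 0 (ω k) ∂chainMeasure γ K
          ≤ ∫⁻ ω, wlCost 𝒳 𝒴 j (ω (i + 1)) ∂chainMeasure γ K + j * ε := ih (i + 1) (by omega)
        _ = ∫⁻ ω, ∫⁻ q, wlCost 𝒳 𝒴 j q ∂(K i (ω i)) ∂chainMeasure γ K + j * ε := by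
          rw [lintegral_chainMeasure_succ γ K i (measurable_of_countable _)]
        _ ≤ ∫⁻ ω, (wlCost 𝒳 𝒴 (j + 1) (ω i) + ε) ∂chainMeasure γ K + j * ε := by
          gcongr with ω
          have hj : k - i - 1 = j := by omega
          have := (hκε j (ω i)).le
          rwa [← hj] at this ⊢
        _ = _ := by
          rw [lintegral_add_right _ measurable_const, lintegral_const, measure_univ, mul_one]
          push_cast
          ring
  rw [lintegral_map (f := fun ω => wlCost 𝒳 𝒴 0 (pairAt k ω))
    ((measurable_of_countable (wlCost 𝒳 𝒴 0)).comp (measurable_pairAt k)) measurable_unzipPath]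
  calc ∫⁻ ω, wlCost 𝒳 𝒴 0 (ω k) ∂chainMeasure γ K
      ≤ ∫⁻ ω, wlCost 𝒳 𝒴 k (ω 0) ∂chainMeasure γ K + k * ε := key k 0 (zero_add k)
    _ = ∫⁻ q, wlCost 𝒳 𝒴 k q ∂γ + k * ε := by
      conv_rhs => rw [← chainMeasure_map_zero γ K]
      rw [lintegral_map (measurable_of_countable _) (by fun_prop)]
    _ ≤ dWL k 𝒳 𝒴 + ε + k * ε := by gcongr
    _ = dWL k 𝒳 𝒴 + (k + 1) * ε := by ring

end WL

end

theorem mainTheorem1 {X Y Z : Type*} [MetricSpace Z]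
    [MeasurableSpace X] [Finite X] [DiscreteMeasurableSpace X]
    [MeasurableSpace Y] [Finite Y] [DiscreteMeasurableSpace Y]
    (𝒳 : LMMC X Z) (𝒴 : LMMC Y Z) (k : ℕ) :
    dWL k 𝒳 𝒴 < ∞ ∧
    dWL k 𝒳 𝒴 =
      ⨅ (P : Measure ((ℕ → X) × (ℕ → Y))) (_ : IsMarkovianCoupling 𝒳.toMMC 𝒴.toMMC P),
        ∫⁻ ω, edist (𝒳.label (ω.1 k)) (𝒴.label (ω.2 k)) ∂P := by
  refine ⟨dWL_lt_top 𝒳 𝒴 k, le_antisymm ?_ ?_⟩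
  · exact le_iInf₂ fun P hP => dWL_le_of_isMarkovianCoupling 𝒳 𝒴 hP k
  · refine ENNReal.le_of_forall_pos_le_add fun ε hε _ => ?_
    have hk : (k + 1 : ℝ≥0∞) ≠ 0 := by simp
    have hk' : (k + 1 : ℝ≥0∞) ≠ ∞ := by simp
    -- The error is shared between the initial coupling and the k steps.
    obtain ⟨P, hP, hle⟩ := exists_isMarkovianCoupling_le 𝒳 𝒴 k (ε := ε / (k + 1))
      (ENNReal.div_ne_zero.2 ⟨by simpa using hε.ne', hk'⟩)
    rw [ENNReal.mul_div_cancel hk hk'] at hle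
    exact (iInf₂_le P hP).trans hle
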